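/- Theorem (Ehrhart). Let $P \subset \mathbf{R}^n$ be a nonempty integral polytope, that is, the convex hull of a nonempty finite set of points of $\mathbf{Z}^n$, and let $d$ be the dimension of $P$, i.e. the dimension of its affine span. For an integer $t \ge 0$ write $tP = \{tx : x \in P\}$. Then $tP \cap \mathbf{Z}^n$ is finite for every integer $t \ge 0$, and there is a polynomial $L_P(t)$ with rational coefficients, of degree exactly $d$, such that $$\#(tP \cap \mathbf{Z}^n) = L_P(t) \qquad \text{for all integers } t \ge 0.$$ -/

import Mathlib

open scoped Pointwise

/-- The set `ℤⁿ` of integral points of `ℝⁿ`. -/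
def integralPoints (n : ℕ) : Set (Fin n → ℝ) :=
  Set.range fun (z : Fin n → ℤ) (i : Fin n) => (z i : ℝ)

/-- `P ⊆ ℝⁿ` is an integral polytope: the convex hull of finitely many integral points. -/
def IsIntegralPolytope {n : ℕ} (P : Set (Fin n → ℝ)) : Prop :=
  ∃ S : Set (Fin n → ℝ), S.Finite ∧ S ⊆ integralPoints n ∧ P = convexHull ℝ S

/-- The dimension of a (nonempty) polytope: the dimension of its affine span. -/
noncomputable def polytopeDim {n : ℕ} (P : Set (Fin n → ℝ)) : ℕ :=
  Module.finrank ℝ (affineSpan ℝ P).direction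

/-!
Let `P` be the convex hull of the integral points `v₀, …, vₘ`. The points of `t • P` are the sums
`∑ lᵢ vᵢ` with `l ≥ 0` and `∑ lᵢ = t`; `homogMap` sends `l` to the pair `(∑ lᵢ vᵢ, ∑ lᵢ)`. Among all
coefficient vectors of a given point there is exactly one that is lexicographically largest
(`exists_isLexOptimal`, `IsLexOptimal.unique`), so that lattice points of `t • P` may be counted by
their optimal coefficient vectors (`smul_convexHull_inter_integralPoints`). This plays the role of a
pulling triangulation, and two facts replace the geometry of one:

* whether `l` is optimal depends only on its support, and the index `0` may be freely added to or
  removed from it (`IsLexOptimal.of_support`);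
* the points `vᵢ` with `i` in the support of `l` or `i = 0` are affinely independent
  (`IsLexOptimal.eq_zero_of_map_eq_zero`).

Write an optimal `l` as `w + a` with `a` integral, `w₀ ∈ [0, 1)` and `wᵢ ∈ (0, 1]` for the other `i`
in the support. Both `w` and `l` have the same support up to `0`, so `w` is optimal again, it
represents a lattice point of `h • P` with `h = ∑ wᵢ`, and only finitely many `w` arise
(`finite_fundamentalSet`). Conversely any natural vector `a` supported on the support of `w` and `0`
may be added to `w`. If this index set has `k + 1` elements, then the number of `a` with
`∑ aᵢ = t - h` is `(t - h + k).choose k`. Because `w₀ < 1`, the height satisfies `h ≤ k`, and the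
count is the polynomial `(t + (k - h)).choose k` for all `t ≥ 0`, including `t < h`, where it vanishes
(`ncard_fracPart_fiber`). The half-open interval at the index `0`, common to all the cones, is what
makes the formula valid for small `t`, in particular for `t = 0`.

Summing over `w` gives the polynomial. Its degree is at most `dim P` since the supports are affinely
independent (`card_augSupport_le_polytopeDim`), and at least `d = dim P` since the combinations of
`d + 1` affinely independent points `vᵢ` with natural coefficients of sum `t` already produce
`(t + d).choose d` lattice points of `t • P`
(`choose_le_ncard`, `le_degree_of_choose_le_eval`).
-/

/-! ### Lexicographically optimal nonnegative vectors -/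

section Lex

variable {m : ℕ} {W : Type*} [AddCommGroup W] [Module ℝ W]

/-- A real vector is lexicographically positive if its first nonzero coordinate is positive. -/
def LexPos (a : Fin (m + 1) → ℝ) : Prop :=
  ∃ i, 0 < a i ∧ ∀ j < i, a j = 0

/-- A nonnegative coefficient vector is lexicographically optimal for the linear map `Φ` if no
nonnegative vector with the same image under `Φ` is lexicographically larger. -/
def IsLexOptimal (Φ : (Fin (m + 1) → ℝ) →ₗ[ℝ] W) (l : Fin (m + 1) → ℝ) : Prop :=
  (∀ i, 0 ≤ l i) ∧ ∀ u : Fin (m + 1) → ℝ, (∀ i, 0 ≤ u i) → Φ u = Φ l → ¬ LexPos (u - l)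

/-- The support of a coefficient vector, with the index `0` adjoined. -/
noncomputable def augSupport (l : Fin (m + 1) → ℝ) : Finset (Fin (m + 1)) :=
  {i | i = 0 ∨ l i ≠ 0}

lemma mem_augSupport {l : Fin (m + 1) → ℝ} {i : Fin (m + 1)} :
    i ∈ augSupport l ↔ i = 0 ∨ l i ≠ 0 := by
  simp [augSupport]

lemma lexPos_or_lexPos_neg {a : Fin (m + 1) → ℝ} (ha : a ≠ 0) : LexPos a ∨ LexPos (-a) := by
  classical
  obtain ⟨i, hi⟩ := Function.ne_iff.mp ha
  have hne : (Finset.univ.filter fun i => a i ≠ 0).Nonempty := ⟨i, by simpa using hi⟩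
  set k := (Finset.univ.filter fun i => a i ≠ 0).min' hne
  have hk0 : a k ≠ 0 := by
    have := Finset.min'_mem _ hne
    simpa using this
  have hlt : ∀ j < k, a j = 0 := by
    intro j hj
    by_contra h
    exact absurd (Finset.min'_le _ j (by simpa using h)) (not_le.mpr hj)
  rcases hk0.lt_or_gt with h | h
  · exact Or.inr ⟨k, by simpa using h, fun j hj => by simp [hlt j hj]⟩
  · exact Or.inl ⟨k, h, hlt⟩

lemma LexPos.smul {a : Fin (m + 1) → ℝ} (ha : LexPos a) {c : ℝ} (hc : 0 < c) :
    LexPos (c • a) := by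
  obtain ⟨i, hi, hj⟩ := ha
  exact ⟨i, by simpa using mul_pos hc hi, fun j h => by simp [hj j h]⟩

lemma LexPos.nonneg_zero {a : Fin (m + 1) → ℝ} (ha : LexPos a) : 0 ≤ a 0 := by
  obtain ⟨i, hi, hj⟩ := ha
  rcases (Fin.zero_le i).eq_or_lt with h | h
  · exact h ▸ hi.le
  · exact (hj 0 h).ge

lemma exists_lexMax_of_isCompact {K : Set (Fin (m + 1) → ℝ)} (hK : IsCompact K)
    (hne : K.Nonempty) : ∃ x ∈ K, ∀ y ∈ K, ¬ LexPos (y - x) := by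
  have key : ∀ k : ℕ, ∃ x ∈ K, ∀ y ∈ K,
      ¬ ∃ i : Fin (m + 1), (i : ℕ) < k ∧ 0 < (y - x) i ∧ ∀ j < i, (y - x) j = 0 := by
    intro k
    induction k with
    | zero => exact ⟨hne.some, hne.some_mem, fun y _ ⟨i, hi, _⟩ => absurd hi (by simp)⟩
    | succ k ih =>
      obtain ⟨x, hx, hmax⟩ := ih
      by_cases hk : k < m + 1
      · -- Among the vectors of `K` that agree with `x` before the `k`-th coordinate, maximize it.
        have hcl : IsClosed (⋂ j : Fin (m + 1), ⋂ _ : (j : ℕ) < k,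
            {y : Fin (m + 1) → ℝ | y j = x j}) :=
          isClosed_iInter fun j => isClosed_iInter fun _ =>
            isClosed_eq (continuous_apply j) continuous_const
        obtain ⟨z, hz, hzmax⟩ := (hK.inter_right hcl).exists_isMaxOn
          ⟨x, hx, by simp⟩ (continuous_apply (⟨k, hk⟩ : Fin (m + 1))).continuousOn
        have hzx : ∀ j : Fin (m + 1), (j : ℕ) < k → z j = x j := by
          simpa using hz.2
        refine ⟨z, hz.1, ?_⟩
        rintro y hy ⟨i, hik, hpos, hzero⟩
        rcases (Nat.lt_succ_iff.mp hik).lt_or_eq with hik | hik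
        · refine hmax y hy ⟨i, hik, ?_, fun j hj => ?_⟩
          · simpa [hzx i hik] using hpos
          · simpa [hzx j (lt_trans hj hik)] using hzero j hj
        · have hi : i = ⟨k, hk⟩ := Fin.ext hik
          have hyK : y ∈ K ∩ ⋂ j : Fin (m + 1), ⋂ _ : (j : ℕ) < k, {y | y j = x j} := by
            refine ⟨hy, ?_⟩
            simp only [Set.mem_iInter]
            intro j hj
            have := hzero j (by rw [Fin.lt_def, hik]; exact hj)
            have h2 : y j = z j := by simpa [sub_eq_zero] using this
            exact h2.trans (hzx j hj)
          have := hzmax hyK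
          simp only [Set.mem_ofPred] at this
          rw [← hi] at this
          simp only [Pi.sub_apply] at hpos
          linarith
      · refine ⟨x, hx, ?_⟩
        rintro y hy ⟨i, -, h⟩
        exact hmax y hy ⟨i, by omega, h⟩
  obtain ⟨x, hx, hmax⟩ := key (m + 1)
  exact ⟨x, hx, fun y hy ⟨i, h⟩ => hmax y hy ⟨i, i.2, h⟩⟩

variable {Φ : (Fin (m + 1) → ℝ) →ₗ[ℝ] W}

lemma IsLexOptimal.unique {l u : Fin (m + 1) → ℝ} (hl : IsLexOptimal Φ l)
    (hu : IsLexOptimal Φ u) (h : Φ l = Φ u) : l = u := by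
  by_contra hne
  rcases lexPos_or_lexPos_neg (sub_ne_zero.mpr hne) with h1 | h1
  · exact hu.2 l hl.1 h h1
  · exact hl.2 u hu.1 h.symm (by simpa using h1)

lemma exists_pos_nonneg_add_smul {l a : Fin (m + 1) → ℝ} (hl : ∀ i, 0 ≤ l i)
    (ha : ∀ i, l i = 0 → 0 ≤ a i) : ∃ e : ℝ, 0 < e ∧ ∀ i, 0 ≤ (l + e • a) i := by
  have h : ∀ i, ∀ᶠ e : ℝ in nhdsWithin 0 (Set.Ioi 0), 0 ≤ (l + e • a) i := by
    intro i
    rcases (hl i).eq_or_lt with h0 | h0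
    · filter_upwards [self_mem_nhdsWithin] with e he
      simpa [← h0] using mul_nonneg (le_of_lt he) (ha i h0.symm)
    · have hc : Filter.Tendsto (fun e : ℝ => (l + e • a) i) (nhds 0) (nhds (l i)) := by
        have : Continuous fun e : ℝ => (l + e • a) i := by
          simp only [Pi.add_apply, Pi.smul_apply, smul_eq_mul]; fun_prop
        simpa using this.tendsto 0
      exact ((hc.mono_left nhdsWithin_le_nhds).eventually (lt_mem_nhds h0)).mono fun _ => le_of_lt
  obtain ⟨e, he, hpos⟩ := ((Filter.eventually_all.mpr h).and self_mem_nhdsWithin).exists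
  exact ⟨e, hpos, he⟩

/-- An optimal vector cannot be moved along a lexicographically positive direction `a` in the kernel
of `Φ`. A negative coordinate `a i` is harmless if `l i > 0`, and at the index `0` it cannot occur. -/
lemma IsLexOptimal.not_lexPos {l a : Fin (m + 1) → ℝ} (hl : IsLexOptimal Φ l)
    (ha : ∀ i ∉ augSupport l, 0 ≤ a i) (hΦ : Φ a = 0) : ¬ LexPos a := by
  intro hpos
  obtain ⟨e, he, hnn⟩ := exists_pos_nonneg_add_smul (a := a) hl.1 (fun i hi => by
    by_cases h0 : i = 0
    · exact h0 ▸ hpos.nonneg_zero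
    · exact ha i (by simp [mem_augSupport, h0, hi]))
  exact hl.2 _ hnn (by simp [hΦ]) (by simpa using hpos.smul he)

/-- Optimality depends only on the augmented support. Adjoining the index `0` is harmless because
the lexicographic order compares the coordinate `0` first. -/
lemma IsLexOptimal.of_support {l u : Fin (m + 1) → ℝ} (hl : IsLexOptimal Φ l)
    (hu : ∀ i, 0 ≤ u i) (hsupp : ∀ i ∉ augSupport l, u i = 0) : IsLexOptimal Φ u := by
  refine ⟨hu, fun x hx hΦ => hl.not_lexPos (fun i hi => ?_) (by simp [hΦ])⟩
  simpa [hsupp i hi] using hx i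

/-- The restriction of `Φ` to vectors supported on the augmented support of an optimal vector is
injective. -/
lemma IsLexOptimal.eq_zero_of_map_eq_zero {l a : Fin (m + 1) → ℝ} (hl : IsLexOptimal Φ l)
    (ha : ∀ i ∉ augSupport l, a i = 0) (hΦ : Φ a = 0) : a = 0 := by
  by_contra hne
  rcases lexPos_or_lexPos_neg hne with h | h
  · exact hl.not_lexPos (fun i hi => (ha i hi).ge) hΦ h
  · exact hl.not_lexPos (fun i hi => by simp [ha i hi]) (by simp [hΦ]) h

end Lex

/-! ### Coefficient vectors of lattice points -/

/-- The linear map sending coefficients `l` to `(∑ lᵢ vᵢ, ∑ lᵢ)`: points of `t • P` are the first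
components of images of nonnegative vectors with second component `t`. -/
noncomputable def homogMap {n m : ℕ} (V : Fin (m + 1) → Fin n → ℤ) :
    (Fin (m + 1) → ℝ) →ₗ[ℝ] (Fin n → ℝ) × ℝ :=
  Fintype.linearCombination ℝ fun i => ((fun j => (V i j : ℝ)), (1 : ℝ))

section Homog

variable {n m : ℕ} {V : Fin (m + 1) → Fin n → ℤ}

lemma homogMap_fst (l : Fin (m + 1) → ℝ) :
    (homogMap V l).1 = ∑ i, l i • fun j => (V i j : ℝ) := by
  simp [homogMap, Fintype.linearCombination_apply, Prod.fst_sum]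

lemma homogMap_snd (l : Fin (m + 1) → ℝ) : (homogMap V l).2 = ∑ i, l i := by
  simp [homogMap, Fintype.linearCombination_apply, Prod.snd_sum]

lemma exists_isLexOptimal {u : Fin (m + 1) → ℝ} (hu : ∀ i, 0 ≤ u i) :
    ∃ l, IsLexOptimal (homogMap V) l ∧ homogMap V l = homogMap V u := by
  set K : Set (Fin (m + 1) → ℝ) := {x | (∀ i, 0 ≤ x i) ∧ homogMap V x = homogMap V u}
  have hsub : K ⊆ Set.pi Set.univ fun _ => Set.Icc 0 (∑ i, u i) := by
    rintro x ⟨hx, hΦ⟩ i -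
    refine ⟨hx i, ?_⟩
    rw [← homogMap_snd (V := V), ← hΦ, homogMap_snd]
    exact Finset.single_le_sum (fun j _ => hx j) (Finset.mem_univ i)
  have hcl : IsClosed K := by
    have h1 : IsClosed {x : Fin (m + 1) → ℝ | ∀ i, 0 ≤ x i} := by
      simp only [Set.ofPred_forall]
      exact isClosed_iInter fun i => isClosed_le continuous_const (continuous_apply i)
    exact h1.inter (isClosed_eq (homogMap V).continuous_of_finiteDimensional continuous_const)
  have hcomp : IsCompact K :=
    (isCompact_univ_pi fun _ => isCompact_Icc).of_isClosed_subset hcl hsub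
  obtain ⟨l, hl, hmax⟩ := exists_lexMax_of_isCompact hcomp ⟨u, hu, rfl⟩
  exact ⟨l, ⟨hl.1, fun x hx hΦ => hmax x ⟨hx, hΦ.trans hl.2⟩⟩, hl.2⟩

end Homog

lemma Finset.card_piAntidiag_succ {ι : Type*} [DecidableEq ι] {s : Finset ι} {k : ℕ}
    (hs : s.card = k + 1) (n : ℕ) : (s.piAntidiag n).card = (n + k).choose k := by
  have h : (s.piAntidiag n).card = (s.finsuppAntidiag n).card := by simp [Finset.finsuppAntidiag]
  rw [h, Finset.card_finsuppAntidiag_nat_eq_choose, hs, show k + 1 + n - 1 = n + k by omega,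
    Nat.choose_symm_add]

/-! ### Counting optimal vectors by their fractional parts -/

section Counting

variable {n m : ℕ} {V : Fin (m + 1) → Fin n → ℤ}

/-- The lexicographically optimal coefficient vectors of the lattice points of `t • P`, where `P`
is the convex hull of the points `V i`. -/
def optimalLattice (V : Fin (m + 1) → Fin n → ℤ) (t : ℕ) : Set (Fin (m + 1) → ℝ) :=
  {l | IsLexOptimal (homogMap V) l ∧ (homogMap V l).1 ∈ integralPoints n ∧ ∑ i, l i = t}

lemma le_of_mem_optimalLattice {t : ℕ} {l : Fin (m + 1) → ℝ} (hl : l ∈ optimalLattice V t)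
    (i : Fin (m + 1)) : l i ≤ t :=
  hl.2.2 ▸ Finset.single_le_sum (fun j _ => hl.1.1 j) (Finset.mem_univ i)

lemma injOn_homogMap_fst (t : ℕ) :
    Set.InjOn (fun l => (homogMap V l).1) (optimalLattice V t) := by
  intro l hl u hu h
  refine hl.1.unique hu.1 (Prod.ext h ?_)
  rw [homogMap_snd, homogMap_snd, hl.2.2, hu.2.2]

lemma finite_optimalLattice (V : Fin (m + 1) → Fin n → ℤ) (t : ℕ) :
    (optimalLattice V t).Finite := by
  set M : Fin n → ℤ := fun j => ∑ i, t * |V i j|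
  refine Set.Finite.of_finite_image (((Set.finite_Icc (-M) M).image
    (fun z : Fin n → ℤ => fun j => (z j : ℝ))).subset ?_) (injOn_homogMap_fst t)
  rintro _ ⟨l, hl, rfl⟩
  obtain ⟨z, hz⟩ := hl.2.1
  refine ⟨z, ?_, hz⟩
  have hle : ∀ j, |z j| ≤ M j := by
    intro j
    have h1 : (z j : ℝ) = ∑ i, l i * V i j := by
      have := congrFun hz j
      simpa [homogMap_fst] using this
    have h2 : |(z j : ℝ)| ≤ ∑ i, (t : ℝ) * |(V i j : ℝ)| := by
      rw [h1]
      refine (Finset.abs_sum_le_sum_abs _ _).trans (Finset.sum_le_sum fun i _ => ?_)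
      rw [abs_mul, abs_of_nonneg (hl.1.1 i)]
      exact mul_le_mul_of_nonneg_right (le_of_mem_optimalLattice hl i) (abs_nonneg _)
    have h3 : ((|z j| : ℤ) : ℝ) ≤ ((M j : ℤ) : ℝ) := by
      simpa [M] using h2
    exact_mod_cast h3
  exact ⟨fun j => (abs_le.mp (hle j)).1, fun j => (abs_le.mp (hle j)).2⟩

/-- The integer part of a nonnegative coefficient vector: rounded down in coordinate `0`, and
rounded down to the largest integer *strictly* below in the other positive coordinates, so that the
fractional parts lie in `[0, 1)` and in `(0, 1]` respectively. Zero coordinates have integer part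
`0` since `0 - 1 = 0` in `ℕ`. -/
noncomputable def natPart (l : Fin (m + 1) → ℝ) (i : Fin (m + 1)) : ℕ :=
  if i = 0 then ⌊l i⌋₊ else ⌈l i⌉₊ - 1

/-- The fractional part complementary to `natPart`. -/
noncomputable def fracPart (l : Fin (m + 1) → ℝ) (i : Fin (m + 1)) : ℝ :=
  l i - natPart l i

/-- The union of the half-open fundamental parallelepipeds: the possible fractional parts of the
optimal coefficient vectors of lattice points. -/
def fundamentalSet (V : Fin (m + 1) → Fin n → ℤ) : Set (Fin (m + 1) → ℝ) :=
  {w | (∃ h : ℕ, w ∈ optimalLattice V h) ∧ w 0 < 1 ∧ ∀ i, w i ≤ 1}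

lemma fracPart_zero_mem {l : Fin (m + 1) → ℝ} (hl : 0 ≤ l 0) :
    0 ≤ fracPart l 0 ∧ fracPart l 0 < 1 := by
  simp only [fracPart, natPart, if_true]
  exact ⟨sub_nonneg.mpr (Nat.floor_le hl), by linarith [Nat.lt_floor_add_one (l 0)]⟩

lemma fracPart_mem {l : Fin (m + 1) → ℝ} {i : Fin (m + 1)} (hi : i ≠ 0) (hl : 0 < l i) :
    0 < fracPart l i ∧ fracPart l i ≤ 1 := by
  have hc : 1 ≤ ⌈l i⌉₊ := Nat.one_le_ceil_iff.mpr hl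
  simp only [fracPart, natPart, if_neg hi]
  rw [Nat.cast_sub hc]
  have h1 := Nat.le_ceil (l i)
  have h2 := Nat.ceil_lt_add_one hl.le
  push_cast
  constructor <;> linarith

lemma natPart_eq_zero {l : Fin (m + 1) → ℝ} {i : Fin (m + 1)} (hl : l i = 0) :
    natPart l i = 0 := by
  simp [natPart, hl]

lemma natPart_eq_zero_of_notMem {l : Fin (m + 1) → ℝ} {i : Fin (m + 1)}
    (hi : i ∉ augSupport l) : natPart l i = 0 :=
  natPart_eq_zero (by_contra fun h => hi (mem_augSupport.mpr (Or.inr h)))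

lemma fracPart_eq_zero {l : Fin (m + 1) → ℝ} {i : Fin (m + 1)} (hl : l i = 0) :
    fracPart l i = 0 := by
  simp [fracPart, natPart_eq_zero hl, hl]

lemma fracPart_nonneg {l : Fin (m + 1) → ℝ} (hl : ∀ i, 0 ≤ l i) (i : Fin (m + 1)) :
    0 ≤ fracPart l i := by
  by_cases hi : i = 0
  · subst hi; exact (fracPart_zero_mem (hl 0)).1
  · rcases (hl i).eq_or_lt with h | h
    · exact (fracPart_eq_zero h.symm).ge
    · exact (fracPart_mem hi h).1.le

lemma fracPart_le_one {l : Fin (m + 1) → ℝ} (hl : ∀ i, 0 ≤ l i) (i : Fin (m + 1)) :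
    fracPart l i ≤ 1 := by
  by_cases hi : i = 0
  · subst hi; exact (fracPart_zero_mem (hl 0)).2.le
  · rcases (hl i).eq_or_lt with h | h
    · simp [fracPart_eq_zero h.symm]
    · exact (fracPart_mem hi h).2

lemma augSupport_fracPart {l : Fin (m + 1) → ℝ} (hl : ∀ i, 0 ≤ l i) :
    augSupport (fracPart l) = augSupport l := by
  ext i
  simp only [mem_augSupport]
  by_cases hi : i = 0
  · simp [hi]
  · rcases (hl i).eq_or_lt with h | h
    · simp [fracPart_eq_zero h.symm, ← h]
    · simp [(fracPart_mem hi h).1.ne', h.ne']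

lemma natPart_add {w : Fin (m + 1) → ℝ} {a : Fin (m + 1) → ℕ} (hw : ∀ i, 0 ≤ w i)
    (hw0 : w 0 < 1) (hw1 : ∀ i, w i ≤ 1) (ha : ∀ i, a i ≠ 0 → i ∈ augSupport w) :
    natPart (fun i => w i + a i) = a := by
  funext i
  by_cases hi : i = 0
  · subst hi
    simp only [natPart, if_true]
    rw [Nat.floor_add_natCast (hw 0), Nat.floor_eq_zero.mpr hw0, zero_add]
  · simp only [natPart, if_neg hi]
    rcases (hw i).eq_or_lt with h | h
    · have : a i = 0 := by
        by_contra h0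
        rcases mem_augSupport.mp (ha i h0) with h1 | h1
        · exact hi h1
        · exact h1 h.symm
      simp [← h, this]
    · rw [Nat.ceil_add_natCast h.le]
      have : ⌈w i⌉₊ = 1 := (Nat.ceil_eq_iff one_ne_zero).mpr ⟨by simpa using h, by simpa using hw1 i⟩
      omega

lemma sum_natPart_add_sum_fracPart (l : Fin (m + 1) → ℝ) :
    ((∑ i, natPart l i : ℕ) : ℝ) + ∑ i, fracPart l i = ∑ i, l i := by
  push_cast
  rw [← Finset.sum_add_distrib]
  simp [fracPart]

lemma homogMap_natCast_fst_mem (a : Fin (m + 1) → ℕ) :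
    (homogMap V fun i => (a i : ℝ)).1 ∈ integralPoints n :=
  ⟨∑ i, a i • V i, by funext j; simp [homogMap_fst]⟩

lemma add_mem_integralPoints {x y : Fin n → ℝ} (hx : x ∈ integralPoints n)
    (hy : y ∈ integralPoints n) : x + y ∈ integralPoints n := by
  obtain ⟨a, rfl⟩ := hx
  obtain ⟨b, rfl⟩ := hy
  exact ⟨a + b, by funext j; simp⟩

lemma sub_mem_integralPoints {x y : Fin n → ℝ} (hx : x ∈ integralPoints n)
    (hy : y ∈ integralPoints n) : x - y ∈ integralPoints n := by
  obtain ⟨a, rfl⟩ := hx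
  obtain ⟨b, rfl⟩ := hy
  exact ⟨a - b, by funext j; simp⟩

lemma exists_card_augSupport (w : Fin (m + 1) → ℝ) : ∃ k, (augSupport w).card = k + 1 :=
  Nat.exists_eq_succ_of_ne_zero (Finset.card_ne_zero_of_mem (mem_augSupport.mpr (Or.inl rfl)))

/-- The height of an element of the fundamental set is less than the number of generators of its
cone; it is here that the half-open interval `[0, 1)` in coordinate `0` enters. -/
lemma height_lt_card_augSupport {w : Fin (m + 1) → ℝ} {h : ℕ} (hw : w ∈ optimalLattice V h)
    (hw0 : w 0 < 1) (hw1 : ∀ i, w i ≤ 1) : h < (augSupport w).card := by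
  have h1 : ∑ i ∈ augSupport w, w i = h := by
    rw [← hw.2.2]
    refine Finset.sum_subset (Finset.subset_univ _) fun i _ hi => ?_
    by_contra h0
    exact hi (mem_augSupport.mpr (Or.inr h0))
  have h2 : ∑ i ∈ augSupport w, w i < ∑ i ∈ augSupport w, (1 : ℝ) :=
    Finset.sum_lt_sum (fun i _ => hw1 i) ⟨0, mem_augSupport.mpr (Or.inl rfl), hw0⟩
  rw [h1] at h2
  simpa using h2

lemma finite_fundamentalSet (V : Fin (m + 1) → Fin n → ℤ) : (fundamentalSet V).Finite := by
  refine ((Set.finite_Iio (m + 2)).biUnion fun h _ => finite_optimalLattice V h).subset ?_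
  rintro w ⟨⟨h, hw⟩, hw0, hw1⟩
  have h1 := height_lt_card_augSupport hw hw0 hw1
  have h2 : (augSupport w).card ≤ m + 1 := by simpa using Finset.card_le_univ (augSupport w)
  simp only [Set.mem_iUnion]
  exact ⟨h, by simp; omega, hw⟩

lemma fracPart_mem_optimalLattice {t : ℕ} {l : Fin (m + 1) → ℝ} (hl : l ∈ optimalLattice V t) :
    ∃ h, h + ∑ i, natPart l i = t ∧ fracPart l ∈ optimalLattice V h := by
  have hsum := sum_natPart_add_sum_fracPart l
  have hnn : 0 ≤ ∑ i, fracPart l i := Finset.sum_nonneg fun i _ => fracPart_nonneg hl.1.1 i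
  rw [hl.2.2] at hsum
  have hle : ∑ i, natPart l i ≤ t := by
    have : ((∑ i, natPart l i : ℕ) : ℝ) ≤ t := by linarith
    exact_mod_cast this
  refine ⟨t - ∑ i, natPart l i, by omega, ?_, ?_, ?_⟩
  · refine hl.1.of_support (fracPart_nonneg hl.1.1) fun i hi => fracPart_eq_zero ?_
    by_contra h0
    exact hi (mem_augSupport.mpr (Or.inr h0))
  · have : fracPart l = l - fun i => (natPart l i : ℝ) := rfl
    rw [this, map_sub, Prod.fst_sub]
    exact sub_mem_integralPoints hl.2.1 (homogMap_natCast_fst_mem _)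
  · rw [Nat.cast_sub hle]
    linarith

lemma add_natCast_mem_optimalLattice {h s : ℕ} {w : Fin (m + 1) → ℝ} {a : Fin (m + 1) → ℕ}
    (hw : w ∈ optimalLattice V h) (ha : ∀ i, a i ≠ 0 → i ∈ augSupport w) (hs : ∑ i, a i = s) :
    (fun i => w i + a i) ∈ optimalLattice V (h + s) := by
  refine ⟨hw.1.of_support (fun i => add_nonneg (hw.1.1 i) (Nat.cast_nonneg _)) fun i hi => ?_,
    ?_, ?_⟩
  · have h1 : w i = 0 := by
      by_contra h0
      exact hi (mem_augSupport.mpr (Or.inr h0))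
    have h2 : a i = 0 := by
      by_contra h0
      exact hi (ha i h0)
    simp [h1, h2]
  · have : (fun i => w i + (a i : ℝ)) = w + fun i => (a i : ℝ) := rfl
    rw [this, map_add, Prod.fst_add]
    exact add_mem_integralPoints hw.2.1 (homogMap_natCast_fst_mem _)
  · rw [Finset.sum_add_distrib, hw.2.2, ← hs]
    push_cast
    ring

/-- The lattice points of `t • P` with prescribed fractional part `w` are counted by a binomial
coefficient, which has the right value `0` also when `t` is smaller than the height `h` of `w`. -/
lemma ncard_fracPart_fiber {w : Fin (m + 1) → ℝ} {h k : ℕ} (hw : w ∈ optimalLattice V h)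
    (hw0 : w 0 < 1) (hw1 : ∀ i, w i ≤ 1) (hk : (augSupport w).card = k + 1) (t : ℕ) :
    {l ∈ optimalLattice V t | fracPart l = w}.ncard = (t + (k - h)).choose k := by
  have hhk : h ≤ k := by
    have := height_lt_card_augSupport hw hw0 hw1
    omega
  rcases lt_or_ge t h with hth | hth
  · rw [Nat.choose_eq_zero_of_lt (by omega)]
    rw [Set.ncard_eq_zero ((finite_optimalLattice V t).subset fun _ hl => hl.1),
      Set.eq_empty_iff_forall_notMem]
    rintro l ⟨hl, rfl⟩
    obtain ⟨h', hh', hl'⟩ := fracPart_mem_optimalLattice hl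
    have : (h : ℝ) = h' := hw.2.2.symm.trans hl'.2.2
    have : h = h' := by exact_mod_cast this
    omega
  · have hcard := Finset.card_piAntidiag_succ hk (t - h)
    rw [show t + (k - h) = t - h + k by omega, ← hcard, ← Set.ncard_coe_finset]
    have himg : {l ∈ optimalLattice V t | fracPart l = w} =
        (fun (a : Fin (m + 1) → ℕ) i => w i + (a i : ℝ)) ''
          ((augSupport w).piAntidiag (t - h) : Set (Fin (m + 1) → ℕ)) := by
      ext l
      constructor
      · rintro ⟨hl, rfl⟩
        obtain ⟨h', hh', hl'⟩ := fracPart_mem_optimalLattice hl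
        have h1 : (h : ℝ) = h' := hw.2.2.symm.trans hl'.2.2
        have h2 : h = h' := by exact_mod_cast h1
        refine ⟨natPart l, ?_, by funext i; simp [fracPart]⟩
        rw [augSupport_fracPart hl.1.1]
        simp only [Finset.mem_coe, Finset.mem_piAntidiag]
        refine ⟨?_, fun i hi => by_contra fun h0 => hi (natPart_eq_zero_of_notMem h0)⟩
        rw [Finset.sum_subset (Finset.subset_univ (augSupport l))
          fun i _ hi => natPart_eq_zero_of_notMem hi]
        omega
      · rintro ⟨a, ha, rfl⟩
        simp only [Finset.mem_coe, Finset.mem_piAntidiag] at ha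
        have hs : ∑ i, a i = t - h := by
          rw [← ha.1]
          exact (Finset.sum_subset (Finset.subset_univ _)
            fun i _ hi => by_contra fun h0 => hi (ha.2 i h0)).symm
        refine ⟨?_, ?_⟩
        · have := add_natCast_mem_optimalLattice hw ha.2 hs
          rwa [show h + (t - h) = t by omega] at this
        · funext i
          simp [fracPart, natPart_add hw.1.1 hw0 hw1 ha.2]
    rw [himg, Set.ncard_image_of_injective]
    intro a b hab
    funext i
    have := congrFun hab i
    simpa using this

lemma ncard_optimalLattice (V : Fin (m + 1) → Fin n → ℤ) (t : ℕ) :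
    (optimalLattice V t).ncard =
      ∑ w ∈ (finite_fundamentalSet V).toFinset, {l ∈ optimalLattice V t | fracPart l = w}.ncard := by
  classical
  rw [Set.ncard_eq_toFinset_card _ (finite_optimalLattice V t),
    Finset.card_eq_sum_card_fiberwise (f := fracPart) (t := (finite_fundamentalSet V).toFinset)]
  · refine Finset.sum_congr rfl fun w _ => ?_
    rw [← Set.ncard_coe_finset]
    congr 1
    ext l
    simp
  · intro l hl
    have hl' : l ∈ optimalLattice V t := by simpa using hl
    obtain ⟨h, -, hmem⟩ := fracPart_mem_optimalLattice hl'
    have hfund : fracPart l ∈ fundamentalSet V :=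
      ⟨⟨h, hmem⟩, (fracPart_zero_mem (hl'.1.1 0)).2, fracPart_le_one hl'.1.1⟩
    simpa using hfund

end Counting

/-! ### Binomial polynomials -/

/-- The binomial coefficient `t ↦ (t + c).choose k` as a rational polynomial in `t`. -/
noncomputable def choosePoly (k c : ℕ) : Polynomial ℚ :=
  Polynomial.C (k.factorial : ℚ)⁻¹ * (descPochhammer ℚ k).comp (Polynomial.X + Polynomial.C (c : ℚ))

lemma choosePoly_eval (k c t : ℕ) : (choosePoly k c).eval (t : ℚ) = (t + c).choose k := by
  have h : (k.factorial : ℚ) ≠ 0 := by exact_mod_cast k.factorial_ne_zero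
  simp only [choosePoly, Polynomial.eval_mul, Polynomial.eval_C, Polynomial.eval_comp,
    Polynomial.eval_add, Polynomial.eval_X]
  rw [← Nat.cast_add, descPochhammer_eval_eq_descFactorial, Nat.descFactorial_eq_factorial_mul_choose]
  push_cast
  field_simp

lemma choosePoly_degree (k c : ℕ) : (choosePoly k c).degree = k := by
  have h : (k.factorial : ℚ)⁻¹ ≠ 0 := inv_ne_zero (by exact_mod_cast k.factorial_ne_zero)
  have hm : ((descPochhammer ℚ k).comp (Polynomial.X + Polynomial.C (c : ℚ))).Monic :=
    (monic_descPochhammer ℚ k).comp_X_add_C _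
  rw [choosePoly, Polynomial.degree_C_mul h, Polynomial.degree_eq_natDegree hm.ne_zero,
    Polynomial.natDegree_comp, Polynomial.natDegree_X_add_C, descPochhammer_natDegree, mul_one]

/-- A polynomial that dominates a binomial coefficient of degree `d` at all natural numbers has
degree at least `d`. -/
lemma le_degree_of_choose_le_eval {L : Polynomial ℚ} {d : ℕ}
    (h : ∀ t : ℕ, ((t + d).choose d : ℚ) ≤ L.eval (t : ℚ)) : (d : WithBot ℕ) ≤ L.degree := by
  by_contra! hlt
  rw [← choosePoly_degree d d] at hlt
  have ho := (Polynomial.isLittleO_atTop_of_degree_lt _ _ hlt).def (c := 1 / 2) (by norm_num)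
  obtain ⟨t, ht⟩ := ((tendsto_natCast_atTop_atTop (R := ℚ)).eventually ho).exists
  rw [choosePoly_eval, ← Rat.norm_cast_real, ← Rat.norm_cast_real, Real.norm_eq_abs,
    Real.norm_eq_abs] at ht
  have h1 : ((((t + d).choose d : ℕ) : ℚ) : ℝ) ≤ ((L.eval (t : ℚ) : ℚ) : ℝ) := Rat.cast_le.mpr (h t)
  have h2 : (1 : ℝ) ≤ ((((t + d).choose d : ℕ) : ℚ) : ℝ) := by
    exact_mod_cast Nat.choose_pos (Nat.le_add_left d t)
  rw [abs_of_nonneg (by linarith), abs_of_nonneg (by linarith)] at ht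
  linarith

/-! ### The lattice points of dilated polytopes -/

section Polytope

variable {n m : ℕ} {V : Fin (m + 1) → Fin n → ℤ}

/-- The real point with integer coordinates `V i`. -/
def realPoint (V : Fin (m + 1) → Fin n → ℤ) (i : Fin (m + 1)) : Fin n → ℝ :=
  fun j => (V i j : ℝ)

lemma convexHull_range_realPoint (V : Fin (m + 1) → Fin n → ℤ) :
    convexHull ℝ (Set.range (realPoint V)) =
      (fun l => (homogMap V l).1) '' stdSimplex ℝ (Fin (m + 1)) := by
  have h : (fun l => (homogMap V l).1) = (LinearMap.fst ℝ _ _ ∘ₗ homogMap V) := rfl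
  rw [h, ← convexHull_basis_eq_stdSimplex, LinearMap.image_convexHull, ← Set.range_comp]
  congr 2
  funext i
  simp [homogMap_fst]
  rfl

lemma mem_smul_convexHull_iff {t : ℕ} {x : Fin n → ℝ} :
    x ∈ (t : ℝ) • convexHull ℝ (Set.range (realPoint V)) ↔
      ∃ l : Fin (m + 1) → ℝ, (∀ i, 0 ≤ l i) ∧ (homogMap V l).1 = x ∧ ∑ i, l i = t := by
  rw [convexHull_range_realPoint, Set.mem_smul_set]
  constructor
  · rintro ⟨_, ⟨l, hl, rfl⟩, rfl⟩
    refine ⟨(t : ℝ) • l, fun i => mul_nonneg t.cast_nonneg (hl.1 i), by simp, ?_⟩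
    simp [← Finset.mul_sum, hl.2]
  · rintro ⟨l, hl, rfl, hs⟩
    rcases t.eq_zero_or_pos with rfl | ht
    · have hl0 : l = 0 := by
        funext i
        rw [Nat.cast_zero, Finset.sum_eq_zero_iff_of_nonneg fun i _ => hl i] at hs
        exact hs i (Finset.mem_univ i)
      exact ⟨_, ⟨_, single_mem_stdSimplex ℝ 0, rfl⟩, by simp [hl0]⟩
    · have ht' : (t : ℝ) ≠ 0 := by positivity
      refine ⟨_, ⟨(t : ℝ)⁻¹ • l, ⟨fun i => mul_nonneg (by positivity) (hl i), ?_⟩, rfl⟩, ?_⟩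
      · simp [← Finset.mul_sum, hs, ht']
      · simp [ht']

/-- Every lattice point of `t • P` is represented by exactly one lexicographically optimal vector
(see also `injOn_homogMap_fst`). -/
lemma smul_convexHull_inter_integralPoints (V : Fin (m + 1) → Fin n → ℤ) (t : ℕ) :
    (t : ℝ) • convexHull ℝ (Set.range (realPoint V)) ∩ integralPoints n =
      (fun l => (homogMap V l).1) '' optimalLattice V t := by
  ext x
  constructor
  · rintro ⟨hx, hint⟩
    obtain ⟨u, hu, rfl, hs⟩ := mem_smul_convexHull_iff.mp hx
    obtain ⟨l, hl, hlu⟩ := exists_isLexOptimal (V := V) hu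
    refine ⟨l, ⟨hl, hlu ▸ hint, ?_⟩, congrArg Prod.fst hlu⟩
    rw [← hs, ← homogMap_snd (V := V), hlu, homogMap_snd]
  · rintro ⟨l, hl, rfl⟩
    exact ⟨mem_smul_convexHull_iff.mpr ⟨l, hl.1.1, rfl, hl.2.2⟩, hl.2.1⟩

/-- Affine independence of points is injectivity of the homogenized coefficient map on vectors
supported on their indices. -/
lemma affineIndependent_realPoint_iff {T : Finset (Fin (m + 1))} :
    AffineIndependent ℝ (fun i : T => realPoint V i) ↔
      ∀ a : Fin (m + 1) → ℝ, (∀ i ∉ T, a i = 0) → homogMap V a = 0 → a = 0 := by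
  rw [affineIndependent_iff_of_fintype]
  constructor
  · intro h a ha hΦ
    have h1 : ∑ i : T, a i = 0 := by
      rw [Finset.sum_coe_sort T a, Finset.sum_subset (Finset.subset_univ T) fun i _ hi => ha i hi,
        ← homogMap_snd (V := V), hΦ, Prod.snd_zero]
    have h2 : ∑ i : T, a i • realPoint V i = 0 := by
      rw [Finset.sum_coe_sort T fun i => a i • realPoint V i,
        Finset.sum_subset (Finset.subset_univ T) fun i _ hi => by simp [ha i hi]]
      exact (homogMap_fst a).symm.trans (by rw [hΦ, Prod.fst_zero])
    funext i
    by_cases hi : i ∈ T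
    · refine h (fun i => a i) h1 ?_ ⟨i, hi⟩
      rw [Finset.weightedVSub_eq_linear_combination _ h1, h2]
    · exact ha i hi
  · intro h u hu hv i
    rw [Finset.weightedVSub_eq_linear_combination _ hu] at hv
    set a : Fin (m + 1) → ℝ := fun i => if hi : i ∈ T then u ⟨i, hi⟩ else 0 with ha
    have haT : ∀ i : T, a i = u i := fun i => by simp [ha]
    have hout : ∀ i ∉ T, a i = 0 := fun i hi => by simp [ha, hi]
    have h0 : a = 0 := by
      refine h a hout (Prod.ext ?_ ?_)
      · rw [homogMap_fst, ← Finset.sum_subset (Finset.subset_univ T)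
          fun i _ hi => by simp [hout i hi], ← Finset.sum_coe_sort T]
        simp only [haT]
        exact hv
      · rw [homogMap_snd, ← Finset.sum_subset (Finset.subset_univ T) fun i _ hi => hout i hi,
          ← Finset.sum_coe_sort T]
        simp only [haT]
        exact hu
    rw [← haT i, h0, Pi.zero_apply]

lemma polytopeDim_convexHull (s : Set (Fin n → ℝ)) :
    polytopeDim (convexHull ℝ s) = Module.finrank ℝ (vectorSpan ℝ s) := by
  rw [polytopeDim, affineSpan_convexHull, direction_affineSpan]

/-- The augmented support of an optimal vector indexes affinely independent points of the polytope,
which bounds the degree of the contribution of that support. -/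
lemma card_augSupport_le_polytopeDim {h k : ℕ} {w : Fin (m + 1) → ℝ} (hw : w ∈ optimalLattice V h)
    (hk : (augSupport w).card = k + 1) :
    k ≤ polytopeDim (convexHull ℝ (Set.range (realPoint V))) := by
  have hind : AffineIndependent ℝ (fun i : augSupport w => realPoint V i) :=
    affineIndependent_realPoint_iff.mpr fun _ ha hΦ => hw.1.eq_zero_of_map_eq_zero ha hΦ
  have hrank := hind.finrank_vectorSpan (n := k) (by simpa using hk)
  rw [polytopeDim_convexHull, ← hrank]
  refine Submodule.finrank_mono (vectorSpan_mono ℝ ?_)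
  rintro _ ⟨i, rfl⟩
  exact ⟨i, rfl⟩

lemma exists_affineIndependent_card (hV : Function.Injective (realPoint V)) :
    ∃ T : Finset (Fin (m + 1)), AffineIndependent ℝ (fun i : T => realPoint V i) ∧
      T.card = polytopeDim (convexHull ℝ (Set.range (realPoint V))) + 1 := by
  classical
  obtain ⟨U, hU, hspan, hind⟩ := exists_affineIndependent ℝ (Fin n → ℝ) (Set.range (realPoint V))
  set T : Finset (Fin (m + 1)) := {i | realPoint V i ∈ U} with hT
  have hmem : ∀ i : T, realPoint V i ∈ U := fun i => (Finset.mem_filter.mp i.2).2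
  have hindT : AffineIndependent ℝ (fun i : T => realPoint V i) :=
    hind.comp_embedding ⟨fun i : T => (⟨realPoint V i, hmem i⟩ : U), fun i j hij =>
      Subtype.ext (hV (congrArg Subtype.val hij))⟩
  have hrange : Set.range (fun i : T => realPoint V i) = U := by
    ext x
    constructor
    · rintro ⟨i, rfl⟩
      exact hmem i
    · intro hx
      obtain ⟨i, rfl⟩ := hU hx
      exact ⟨⟨i, by simpa [hT] using hx⟩, rfl⟩
  have hne : U.Nonempty := by
    rw [← affineSpan_nonempty ℝ, hspan, affineSpan_nonempty]
    exact Set.range_nonempty _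
  obtain ⟨x, hx⟩ := hne
  rw [← hrange] at hx
  obtain ⟨i, -⟩ := hx
  obtain ⟨k, hk⟩ := Nat.exists_eq_succ_of_ne_zero (Finset.card_ne_zero_of_mem i.2)
  refine ⟨T, hindT, ?_⟩
  rw [polytopeDim_convexHull, ← direction_affineSpan, ← hspan, direction_affineSpan, ← hrange,
    hindT.finrank_vectorSpan (by simpa using hk), hk]

/-- The nonnegative integer combinations of affinely independent vertices with coefficient sum `t`
are distinct lattice points of `t • P`. -/
lemma choose_le_ncard {T : Finset (Fin (m + 1))} {d : ℕ}
    (hT : AffineIndependent ℝ (fun i : T => realPoint V i)) (hd : T.card = d + 1) {t : ℕ}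
    (hfin : ((t : ℝ) • convexHull ℝ (Set.range (realPoint V)) ∩ integralPoints n).Finite) :
    (t + d).choose d ≤
      ((t : ℝ) • convexHull ℝ (Set.range (realPoint V)) ∩ integralPoints n).ncard := by
  rw [← Finset.card_piAntidiag_succ hd t, ← Set.ncard_coe_finset]
  have hsum : ∀ a ∈ T.piAntidiag t, ∑ i, (a i : ℝ) = t := by
    intro a ha
    rw [Finset.mem_piAntidiag] at ha
    rw [← ha.1, Nat.cast_sum]
    exact (Finset.sum_subset (Finset.subset_univ T) fun i _ hi => by
      simpa using by_contra fun h0 => hi (ha.2 i h0)).symm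
  refine Set.ncard_le_ncard_of_injOn (fun a => (homogMap V fun i => (a i : ℝ)).1) ?_ ?_ hfin
  · intro a ha
    exact ⟨mem_smul_convexHull_iff.mpr ⟨_, fun i => Nat.cast_nonneg _, rfl, hsum a ha⟩,
      homogMap_natCast_fst_mem a⟩
  · intro a ha b hb hab
    have hzero := affineIndependent_realPoint_iff.mp hT
      ((fun i => (a i : ℝ)) - fun i => (b i : ℝ)) ?_ ?_
    · funext i
      have := congrFun hzero i
      simp only [Pi.sub_apply, Pi.zero_apply, sub_eq_zero] at this
      exact_mod_cast this
    · intro i hi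
      rw [Finset.mem_coe, Finset.mem_piAntidiag] at ha hb
      have h1 : a i = 0 := by_contra fun h0 => hi (ha.2 i h0)
      have h2 : b i = 0 := by_contra fun h0 => hi (hb.2 i h0)
      simp [h1, h2]
    · rw [map_sub, sub_eq_zero]
      exact Prod.ext hab (by rw [homogMap_snd, homogMap_snd, hsum a ha, hsum b hb])

lemma exists_polynomial_ncard_optimalLattice (V : Fin (m + 1) → Fin n → ℤ) :
    ∃ L : Polynomial ℚ,
      L.degree ≤ (polytopeDim (convexHull ℝ (Set.range (realPoint V))) : WithBot ℕ) ∧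
      ∀ t : ℕ, ((optimalLattice V t).ncard : ℚ) = L.eval (t : ℚ) := by
  have hex : ∀ w ∈ (finite_fundamentalSet V).toFinset, ∃ q : Polynomial ℚ,
      q.degree ≤ (polytopeDim (convexHull ℝ (Set.range (realPoint V))) : WithBot ℕ) ∧
      ∀ t : ℕ, ({l ∈ optimalLattice V t | fracPart l = w}.ncard : ℚ) = q.eval (t : ℚ) := by
    intro w hw
    obtain ⟨⟨h, hwh⟩, hw0, hw1⟩ := (finite_fundamentalSet V).mem_toFinset.mp hw
    obtain ⟨k, hk⟩ := exists_card_augSupport w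
    refine ⟨choosePoly k (k - h), ?_, fun t => ?_⟩
    · rw [choosePoly_degree]
      exact_mod_cast card_augSupport_le_polytopeDim hwh hk
    · rw [ncard_fracPart_fiber hwh hw0 hw1 hk, choosePoly_eval]
  choose! q hdeg heval using hex
  refine ⟨∑ w ∈ (finite_fundamentalSet V).toFinset, q w, ?_, fun t => ?_⟩
  · exact (Polynomial.degree_sum_le _ _).trans (Finset.sup_le hdeg)
  · rw [ncard_optimalLattice, Polynomial.eval_finsetSum, Nat.cast_sum]
    exact Finset.sum_congr rfl fun w hw => heval w hw t

lemma exists_realPoint_range {S : Set (Fin n → ℝ)} (hS : S.Finite) (hne : S.Nonempty)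
    (hint : S ⊆ integralPoints n) :
    ∃ (m : ℕ) (V : Fin (m + 1) → Fin n → ℤ), Function.Injective (realPoint V) ∧
      Set.range (realPoint V) = S := by
  obtain ⟨m, hm⟩ := Nat.exists_eq_succ_of_ne_zero
    (Finset.card_ne_zero_of_mem (hS.mem_toFinset.mpr hne.some_mem))
  set e := hS.toFinset.equivFinOfCardEq hm
  have hmem : ∀ i, ((e.symm i : hS.toFinset) : Fin n → ℝ) ∈ S := fun i =>
    hS.mem_toFinset.mp (e.symm i).2
  choose V hV using fun i => hint (hmem i)
  have hV' : realPoint V = fun i => ((e.symm i : hS.toFinset) : Fin n → ℝ) := funext hV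
  refine ⟨m, V, ?_, ?_⟩
  · rw [hV']
    exact Subtype.val_injective.comp e.symm.injective
  · rw [hV']
    ext x
    constructor
    · rintro ⟨i, rfl⟩
      exact hmem i
    · intro hx
      exact ⟨e ⟨x, hS.mem_toFinset.mpr hx⟩, by simp⟩

end Polytope

theorem mainTheorem1 (n d : ℕ) (P : Set (Fin n → ℝ)) (hP : IsIntegralPolytope P)
    (hne : P.Nonempty) (hd : polytopeDim P = d) :
    ∃ L : Polynomial ℚ, L.degree = (d : WithBot ℕ) ∧
      ∀ t : ℕ, (((t : ℝ) • P) ∩ integralPoints n).Finite ∧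
        ((((t : ℝ) • P) ∩ integralPoints n).ncard : ℚ) = L.eval (t : ℚ) := by
  obtain ⟨S, hS, hint, rfl⟩ := hP
  obtain ⟨m, V, hV, rfl⟩ := exists_realPoint_range hS (convexHull_nonempty_iff.mp hne) hint
  subst hd
  obtain ⟨L, hdeg, hL⟩ := exists_polynomial_ncard_optimalLattice V
  have hfin : ∀ t : ℕ,
      ((t : ℝ) • convexHull ℝ (Set.range (realPoint V)) ∩ integralPoints n).Finite := fun t => by
    rw [smul_convexHull_inter_integralPoints]
    exact (finite_optimalLattice V t).image _
  have hcard : ∀ t : ℕ,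
      ((((t : ℝ) • convexHull ℝ (Set.range (realPoint V))) ∩ integralPoints n).ncard : ℚ) =
        L.eval (t : ℚ) := fun t => by
    rw [smul_convexHull_inter_integralPoints, (injOn_homogMap_fst t).ncard_image, hL]
  obtain ⟨T, hT, hTcard⟩ := exists_affineIndependent_card hV
  refine ⟨L, hdeg.antisymm (le_degree_of_choose_le_eval fun t => ?_), fun t => ⟨hfin t, hcard t⟩⟩
  rw [← hcard t]
  exact_mod_cast choose_le_ncard hT hTcard (hfin t)
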